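/- Let $0<a\le b$ be constants. For each number $n$ of agents and each number $m\ge 5n$ of chores, let $\mathcal D_1,\dots,\mathcal D_m$ be probability distributions on $\mathbb R$ supported on $[0,1]$ such that each $\mathcal D_j$ is non-atomic and $(\alpha_j,\beta_j)$-PDF-bounded, i.e. has a probability density function $f_j$ with $\alpha_j\le f_j(x)\le\beta_j$ for all $x\in[0,1]$, where $a\le\alpha_j$ and $\beta_j\le b$ for every $j$. The $\mathcal D_j$ and the numbers $\alpha_j,\beta_j$ may differ between chores and may depend on $n$ and $m$. Let the disutilities $d_i(j)\sim\mathcal D_j$ $(1\le i\le n,\ 1\le j\le m)$ be jointly independent, and put $d_i(S)=\sum_{j\in S}d_i(j)$ for a set $S$ of chores. An allocation is a partition $(A_1,\dots,A_n)$ of the set of all $m$ chores into $n$ (possibly empty) bundles; it is envy-free if $d_i(A_i)\le d_i(A_{i'})$ for all agents $i,i'$. Then, with high probability as $n\to\infty$, an envy-free allocation exists, uniformly over all $m\ge 5n$ and all such distributions: for every $\varepsilon>0$ there is $n_0=n_0(a,b,\varepsilon)$ such that for all $n\ge n_0$, all $m\ge 5n$ and all $\mathcal D_1,\dots,\mathcal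 D_m$ as above, $$\Pr[\text{an envy-free allocation exists}]\ge 1-\varepsilon .$$ -/

import Mathlib

open MeasureTheory ProbabilityTheory

/-- A distribution on the reals is `(α, β)`-PDF-bounded if it has a probability density
function taking values between `α` and `β` at every point of `[0, 1]`. -/
def IsPDFBounded (μ : Measure ℝ) (α β : ℝ) : Prop :=
  ∃ f : ℝ → ℝ, Measurable f ∧ μ = volume.withDensity (fun x => ENNReal.ofReal (f x)) ∧
    ∀ x ∈ Set.Icc (0 : ℝ) 1, α ≤ f x ∧ f x ≤ β

/-- An admissible disutility distribution: a probability distribution supported on `[0, 1]`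
that is non-atomic and `(α, β)`-PDF-bounded. -/
structure IsDisutilityDistribution (μ : Measure ℝ) (α β : ℝ) : Prop where
  isProbabilityMeasure : IsProbabilityMeasure μ
  support : μ (Set.Icc (0 : ℝ) 1)ᶜ = 0
  nonAtomic : ∀ x ∈ Set.Icc (0 : ℝ) 1, μ {x} = 0
  pdfBounded : IsPDFBounded μ α β

/-- The random model with `n` agents and `m` chores: `d i j` is the random disutility of chore `j`
for agent `i`; it has law `D j`, and all the `n * m` disutilities are jointly independent. -/
structure IsRandomChoreInstance {Ω : Type*} [MeasurableSpace Ω] (P : Measure Ω) {n m : ℕ}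
    (D : Fin m → Measure ℝ) (d : Fin n → Fin m → Ω → ℝ) : Prop where
  hasLaw : ∀ i j, HasLaw (d i j) (D j) P
  indep : iIndepFun (fun p : Fin n × Fin m => d p.1 p.2) P

/-- A (complete) allocation of `m` chores to `n` agents: the bundles partition the chores;
bundles may be empty. -/
structure IsAllocation {n m : ℕ} (A : Fin n → Finset (Fin m)) : Prop where
  disjoint : ∀ i i', i ≠ i' → Disjoint (A i) (A i')
  complete : ∀ j, ∃ i, j ∈ A i

/-- The additive disutility of a bundle `S` for an agent whose disutilities of the single chores
are given by `v`. -/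
def bundleDisutility {m : ℕ} (v : Fin m → ℝ) (S : Finset (Fin m)) : ℝ :=
  ∑ j ∈ S, v j

/-- `A` is envy-free for the disutilities `v`: no agent prefers the bundle of another agent. -/
def IsEnvyFree {n m : ℕ} (v : Fin n → Fin m → ℝ) (A : Fin n → Finset (Fin m)) : Prop :=
  ∀ i i', bundleDisutility (v i) (A i) ≤ bundleDisutility (v i) (A i')

/-! Cut the chores into rows of `n` and blocks of five rows, and call a disutility cheap if it is at
most `τ = 12 log n / (a n)`. By Hall's theorem a row fails to match its chores to distinct agents
cheaply with probability at most `n⁻³` (`measureReal_not_rowMatched_le`). In a good block every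
agent's own share costs at most `5τ`, while every other share contains a chore worth more than `25τ`
to that agent: otherwise five chores would be cheap or nearly cheap for both agents at once. So each
good block gives slack `20τ`.

As `m` is unbounded, not all blocks can be made good. Markov's inequality bounds the fraction of bad
ones by `τ / n`, and a bad block costs at most `5n`, so the slack pays for the bad blocks and for
the incomplete last one (`exists_isEnvyFree`). A block is bad with probability of order `(log n)¹⁰ /
n³`, which is small against `τ / n`, uniformly in `m`. -/

lemma measureReal_Iic_le_of_isDisutilityDistribution {μ : Measure ℝ} {α β b t : ℝ}
    (h : IsDisutilityDistribution μ α β) (hb : β ≤ b) (hb0 : 0 ≤ b) (ht : 0 ≤ t) (ht1 : t ≤ 1) :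
    μ.real (Set.Iic t) ≤ b * t := by
  obtain ⟨f, hf, rfl, hbd⟩ := h.pdfBounded
  have hsub : Set.Iic t ⊆ Set.Icc 0 t ∪ (Set.Icc (0 : ℝ) 1)ᶜ := by
    intro x hx
    by_cases h0 : 0 ≤ x
    · exact Or.inl ⟨h0, hx⟩
    · exact Or.inr fun h' => h0 h'.1
  refine ENNReal.toReal_le_of_le_ofReal (mul_nonneg hb0 ht) ?_
  refine (measure_mono hsub).trans ((measure_union_le _ _).trans ?_)
  rw [h.support, add_zero, withDensity_apply _ measurableSet_Icc]
  calc ∫⁻ x in Set.Icc 0 t, ENNReal.ofReal (f x)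
      ≤ ∫⁻ _ in Set.Icc 0 t, ENNReal.ofReal b := by
        refine setLIntegral_mono measurable_const fun x hx => ENNReal.ofReal_le_ofReal ?_
        exact (hbd x ⟨hx.1, hx.2.trans ht1⟩).2.trans hb
    _ = ENNReal.ofReal (b * t) := by
        rw [setLIntegral_const, Real.volume_Icc, sub_zero, ENNReal.ofReal_mul hb0]

lemma measureReal_Ioi_le_of_isDisutilityDistribution {μ : Measure ℝ} {α β a t : ℝ}
    (h : IsDisutilityDistribution μ α β) (ha : a ≤ α) (ha0 : 0 ≤ a) (ht1 : t ≤ 1) :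
    μ.real (Set.Ioi t) ≤ 1 - a * t := by
  have := h.isProbabilityMeasure
  have key : a * t ≤ μ.real (Set.Iic t) := by
    obtain ⟨f, hf, hμ, hbd⟩ := h.pdfBounded
    have h1 : ENNReal.ofReal (a * t) ≤ μ (Set.Icc 0 t) := by
      rw [hμ, withDensity_apply _ measurableSet_Icc]
      calc ENNReal.ofReal (a * t) = ∫⁻ _ in Set.Icc 0 t, ENNReal.ofReal a := by
            rw [setLIntegral_const, Real.volume_Icc, sub_zero, ENNReal.ofReal_mul ha0]
        _ ≤ _ := by
            refine setLIntegral_mono hf.ennreal_ofReal fun x hx => ENNReal.ofReal_le_ofReal ?_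
            exact ha.trans (hbd x ⟨hx.1, hx.2.trans ht1⟩).1
    have h2 := h1.trans (measure_mono (Set.Icc_subset_Iic_self))
    exact (ENNReal.ofReal_le_iff_le_toReal (measure_ne_top _ _)).1 h2
  have : μ.real (Set.Ioi t) = 1 - μ.real (Set.Iic t) := by
    rw [← Set.compl_Iic, probReal_compl_eq_one_sub measurableSet_Iic]
  linarith

/-! ### Union bounds for Hall violations and overlaps -/

namespace IsRandomChoreInstance

variable {Ω : Type*} [MeasurableSpace Ω] {P : Measure Ω} {n m : ℕ}
  {D : Fin m → Measure ℝ} {d : Fin n → Fin m → Ω → ℝ}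

lemma measureReal_forall_mem (h : IsRandomChoreInstance P D d) (s : Finset (Fin n × Fin m))
    (S : Fin n × Fin m → Set ℝ) (hS : ∀ p, MeasurableSet (S p)) :
    P.real {ω | ∀ p ∈ s, d p.1 p.2 ω ∈ S p} = ∏ p ∈ s, (D p.2).real (S p) := by
  have h1 : {ω | ∀ p ∈ s, d p.1 p.2 ω ∈ S p}
      = ⋂ p ∈ s, (fun p : Fin n × Fin m => d p.1 p.2) p ⁻¹' S p := by
    ext ω; simp
  have h2 := h.indep.measure_inter_preimage_eq_mul s (sets := S) (fun p _ => hS p)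
  rw [measureReal_def, h1, h2, ENNReal.toReal_prod]
  refine Finset.prod_congr rfl fun p _ => ?_
  have hl := h.hasLaw p.1 p.2
  rw [measureReal_def, ← hl.map_eq, Measure.map_apply_of_aemeasurable hl.aemeasurable (hS p)]

/-- Union bound over the violations of Hall's condition. -/
lemma measureReal_not_exists_injOn_le [IsProbabilityMeasure P]
    (h : IsRandomChoreInstance P D d) {τ p : ℝ}
    (hp₀ : 0 ≤ p)
    (hp : ∀ j, (D j).real (Set.Ioi τ) ≤ p) (G : Finset (Fin m)) (hG : G.card ≤ n)
    (hn : 0 < n) :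
    P.real {ω | ¬ ∃ g : Fin m → Fin n, Set.InjOn g G ∧ ∀ j ∈ G, d (g j) j ω ≤ τ} ≤
      ∑ u ∈ Finset.Icc 1 n, (n.choose u * n.choose (u - 1) : ℝ) * p ^ ((n + 1 - u) * u) := by
  classical
  set E : Finset (Fin m) → Finset (Fin n) → Set Ω := fun U W =>
    {ω | ∀ q ∈ Wᶜ ×ˢ U, d q.1 q.2 ω ∈ Set.Ioi τ} with hE
  have hsub : {ω | ¬ ∃ g : Fin m → Fin n, Set.InjOn g G ∧ ∀ j ∈ G, d (g j) j ω ≤ τ} ⊆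
      ⋃ u ∈ Finset.Icc 1 n, ⋃ q ∈ G.powersetCard u ×ˢ
        (Finset.univ : Finset (Fin n)).powersetCard (u - 1), E q.1 q.2 := by
    intro ω hω
    set t : G → Finset (Fin n) := fun j => Finset.univ.filter fun i => d i j ω ≤ τ with ht
    by_contra hcon
    apply hω
    have hall : ∀ s : Finset G, s.card ≤ (s.biUnion t).card := by
      intro s
      by_contra! hs
      apply hcon
      have hsn : s.card ≤ n := by
        refine le_trans ?_ hG
        simpa using Finset.card_le_univ s
      -- Padding the neighbourhood to size exactly `s.card - 1` leaves a single size of `W` to sum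
      -- over for each `u`.
      obtain ⟨W, hW, hWc⟩ := Finset.exists_superset_card_eq (s := s.biUnion t) (n := s.card - 1)
        (by omega) (by simp; omega)
      simp only [Set.mem_iUnion]
      refine ⟨s.card, by simp only [Finset.mem_Icc]; omega,
        (s.map (Function.Embedding.subtype _), W), ?_, ?_⟩
      · simp only [Finset.mem_product, Finset.mem_powersetCard, Finset.card_map, Finset.subset_univ,
          hWc, and_true]
        intro j hj
        simp only [Finset.mem_map, Function.Embedding.subtype_apply] at hj
        obtain ⟨x, -, rfl⟩ := hj
        exact x.2
      · rintro ⟨i, j⟩ hij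
        simp only [Finset.mem_product, Finset.mem_compl, Finset.mem_map,
          Function.Embedding.subtype_apply] at hij
        obtain ⟨hi, x, hx, rfl⟩ := hij
        simp only [Set.mem_Ioi]
        by_contra! hle
        exact hi (hW (Finset.mem_biUnion.2 ⟨x, hx, by simp [ht, hle]⟩))
    obtain ⟨f, hf, hft⟩ := (Finset.all_card_le_biUnion_card_iff_exists_injective t).1 hall
    refine ⟨fun j => if hj : j ∈ G then f ⟨j, hj⟩ else ⟨0, hn⟩, ?_, ?_⟩
    · intro x hx y hy hxy
      have hx' : x ∈ G := hx
      have hy' : y ∈ G := hy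
      simp only [hx', hy', dif_pos] at hxy
      simpa using hf hxy
    · intro j hj
      have := hft ⟨j, hj⟩
      simp only [hj, dif_pos]
      simpa [ht] using this
  have hE_le : ∀ U W, P.real (E U W) ≤ p ^ (Wᶜ ×ˢ U).card := by
    intro U W
    rw [hE, h.measureReal_forall_mem _ _ (fun _ => measurableSet_Ioi)]
    refine (Finset.prod_le_prod (fun _ _ => measureReal_nonneg) fun q _ => hp q.2).trans ?_
    rw [Finset.prod_const]
  refine (measureReal_mono hsub (measure_ne_top _ _)).trans
    ((measureReal_biUnion_finset_le _ _).trans ?_)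
  refine Finset.sum_le_sum fun u hu => (measureReal_biUnion_finset_le _ _).trans ?_
  rw [Finset.mem_Icc] at hu
  have hp00 : 0 ≤ p ^ ((n + 1 - u) * u) := pow_nonneg hp₀ _
  have hterm : ∀ q ∈ G.powersetCard u ×ˢ (Finset.univ : Finset (Fin n)).powersetCard (u - 1),
      P.real (E q.1 q.2) ≤ p ^ ((n + 1 - u) * u) := by
    intro q hq
    simp only [Finset.mem_product, Finset.mem_powersetCard] at hq
    refine (hE_le q.1 q.2).trans_eq ?_
    rw [Finset.card_product, Finset.card_compl, Fintype.card_fin, hq.1.2, hq.2.2]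
    congr 2
    omega
  refine (Finset.sum_le_card_nsmul _ _ _ hterm).trans ?_
  rw [nsmul_eq_mul, Finset.card_product, Finset.card_powersetCard, Finset.card_powersetCard,
    Finset.card_univ, Fintype.card_fin]
  refine mul_le_mul_of_nonneg_right ?_ hp00
  exact_mod_cast Nat.mul_le_mul_right _ (Nat.choose_le_choose u hG)

/-- No agent is likely to have five cheap chores in common with another one. -/
lemma measureReal_exists_overlap_le [IsProbabilityMeasure P]
    (h : IsRandomChoreInstance P D d) {τ T p q : ℝ}
    (hp₀ : 0 ≤ p) (hq₀ : 0 ≤ q)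
    (hp : ∀ j, (D j).real (Set.Iic T) ≤ p) (hq : ∀ j, (D j).real (Set.Iic τ) ≤ q)
    (k : ℕ) (G : Finset (Fin m)) {i i' : Fin n} (hi : i ≠ i') :
    P.real {ω | ∃ J ⊆ G, J.card = k ∧ ∀ j ∈ J, d i j ω ≤ T ∧ d i' j ω ≤ τ} ≤
      (G.card : ℝ) ^ k * (p * q) ^ k := by
  classical
  have hsub : {ω | ∃ J ⊆ G, J.card = k ∧ ∀ j ∈ J, d i j ω ≤ T ∧ d i' j ω ≤ τ} ⊆
      ⋃ J ∈ G.powersetCard k, {ω | ∀ r ∈ ({i, i'} : Finset (Fin n)) ×ˢ J,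
        d r.1 r.2 ω ∈ if r.1 = i then Set.Iic T else Set.Iic τ} := by
    rintro ω ⟨J, hJ, hk, hω⟩
    simp only [Set.mem_iUnion, Finset.mem_powersetCard]
    refine ⟨J, ⟨hJ, hk⟩, ?_⟩
    rintro ⟨x, j⟩ hr
    simp only [Finset.mem_product, Finset.mem_insert, Finset.mem_singleton] at hr
    rcases hr with ⟨rfl | rfl, hj⟩
    · simpa using (hω j hj).1
    · simpa [hi.symm] using (hω j hj).2
  refine (measureReal_mono hsub (measure_ne_top _ _)).trans
    ((measureReal_biUnion_finset_le _ _).trans ?_)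
  have hterm : ∀ J ∈ G.powersetCard k, P.real {ω | ∀ r ∈ ({i, i'} : Finset (Fin n)) ×ˢ J,
        d r.1 r.2 ω ∈ if r.1 = i then Set.Iic T else Set.Iic τ} ≤ (p * q) ^ k := by
    intro J hJ
    rw [h.measureReal_forall_mem _ _ (fun r => by split_ifs <;> exact measurableSet_Iic),
      Finset.prod_product_right, ← (Finset.mem_powersetCard.1 hJ).2]
    rw [← Finset.prod_const]
    refine Finset.prod_le_prod (fun _ _ => Finset.prod_nonneg fun _ _ => measureReal_nonneg)
      fun j _ => ?_
    rw [Finset.prod_pair hi]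
    simp only [if_true, hi.symm, if_false]
    exact mul_le_mul (hp j) (hq j) measureReal_nonneg (measureReal_nonneg.trans (hp j))
  refine (Finset.sum_le_card_nsmul _ _ _ hterm).trans ?_
  rw [nsmul_eq_mul, Finset.card_powersetCard]
  refine mul_le_mul_of_nonneg_right ?_ (pow_nonneg (mul_nonneg hp₀ hq₀) _)
  exact_mod_cast Nat.choose_le_pow _ _

end IsRandomChoreInstance

/-- Markov's inequality for the number of events that occur. -/
lemma measureReal_lt_card_filter_le {Ω : Type*} [MeasurableSpace Ω] (P : Measure Ω)
    [IsProbabilityMeasure P] (B : ℕ) (bad : ℕ → Set Ω) {q δ : ℝ} (hδ : 0 < δ) (hB : 0 < B)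
    (hq : ∀ c < B, P.real (bad c) ≤ q) [∀ ω, DecidablePred fun c => ω ∈ bad c] :
    P.real {ω | δ * B < ((Finset.range B).filter fun c => ω ∈ bad c).card} ≤ q / δ := by
  classical
  -- The events need not be measurable; `toMeasurable` enlarges them without changing their measure.
  have hint : ∀ c, Integrable ((toMeasurable P (bad c)).indicator fun _ => (1 : ℝ)) P := fun c =>
    (integrable_const _).indicator (measurableSet_toMeasurable _ _)
  have hm := mul_meas_ge_le_integral_of_nonneg (μ := P)
    (f := fun ω => ∑ c ∈ Finset.range B, (toMeasurable P (bad c)).indicator (fun _ => (1 : ℝ)) ω)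
    (Filter.Eventually.of_forall fun ω => Finset.sum_nonneg fun c _ =>
      Set.indicator_nonneg (fun _ _ => zero_le_one) _)
    (integrable_finsetSum _ fun c _ => hint c) (δ * B)
  rw [integral_finsetSum _ fun c _ => hint c] at hm
  have h1 : ∀ c ∈ Finset.range B,
      ∫ ω, (toMeasurable P (bad c)).indicator (fun _ => (1 : ℝ)) ω ∂P ≤ q := by
    intro c hc
    rw [integral_indicator_const _ (measurableSet_toMeasurable _ _), measureReal_def,
      measure_toMeasurable]
    simpa [measureReal_def] using hq c (Finset.mem_range.1 hc)
  have h2 := Finset.sum_le_card_nsmul _ _ _ h1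
  rw [Finset.card_range, nsmul_eq_mul] at h2
  have h3 : P.real {ω | δ * B < ((Finset.range B).filter fun c => ω ∈ bad c).card} ≤
      P.real {ω | δ * B ≤ ∑ c ∈ Finset.range B,
        (toMeasurable P (bad c)).indicator (fun _ => (1 : ℝ)) ω} := by
    refine measureReal_mono fun ω hω => ?_
    simp only [Set.mem_ofPred_eq] at hω ⊢
    refine hω.le.trans ?_
    rw [Finset.card_filter, Nat.cast_sum]
    refine Finset.sum_le_sum fun c _ => ?_
    by_cases hc : ω ∈ bad c
    · simp [hc, subset_toMeasurable P (bad c) hc]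
    · simp only [hc, if_false, Nat.cast_zero]
      exact Set.indicator_nonneg (fun _ _ => zero_le_one) _
  have hB' : (0 : ℝ) < B := by exact_mod_cast hB
  rw [le_div_iff₀ hδ]
  have h4 := hm.trans h2
  have h5 : B * (P.real {ω | δ * B < ((Finset.range B).filter fun c => ω ∈ bad c).card} * δ)
      ≤ B * q := by
    refine le_trans ?_ h4
    calc _ = δ * B * P.real {ω | δ * B < ((Finset.range B).filter fun c => ω ∈ bad c).card} := by
          ring
      _ ≤ _ := mul_le_mul_of_nonneg_left h3 (by positivity)
  exact le_of_mul_le_mul_left h5 hB'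

/-! ### Rows and blocks of chores -/

/-- The chores with index `j` such that `j / k = r`. -/
def choreBlock (m k r : ℕ) : Finset (Fin m) :=
  Finset.univ.filter fun j => j.val / k = r

lemma mem_choreBlock {m k r : ℕ} {j : Fin m} : j ∈ choreBlock m k r ↔ j.val / k = r := by
  simp [choreBlock]

lemma card_choreBlock_le {m k : ℕ} (hk : 0 < k) (r : ℕ) : (choreBlock m k r).card ≤ k := by
  have h : (choreBlock m k r).card ≤ (Finset.Ico (r * k) (r * k + k)).card := by
    refine Finset.card_le_card_of_injOn Fin.val (fun j hj => ?_) Fin.val_injective.injOn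
    have hj' : j.val / k = r := mem_choreBlock.1 hj
    have h1 := Nat.div_add_mod j.val k
    have h2 := Nat.mod_lt j.val hk
    rw [hj', mul_comm] at h1
    simp only [Finset.coe_Ico, Set.mem_Ico]
    omega
  simpa using h

lemma card_choreBlock_eq {m k r : ℕ} (hk : 0 < k) (hr : (r + 1) * k ≤ m) :
    (choreBlock m k r).card = k := by
  refine le_antisymm (card_choreBlock_le hk r) ?_
  have h : (Finset.univ : Finset (Fin k)).card ≤ (choreBlock m k r).card := by
    refine Finset.card_le_card_of_injOn
      (fun x => ⟨r * k + x.val, by have := x.2; rw [add_mul] at hr; omega⟩) (fun x _ => ?_) ?_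
    · refine mem_choreBlock.2 ?_
      have := x.2
      simp only
      rw [mul_comm, Nat.mul_add_div hk, Nat.div_eq_of_lt this, add_zero]
    · intro x _ y _ hxy
      simp only [Fin.mk.injEq] at hxy
      exact Fin.ext (by omega)
  simpa using h

/-! ### Envy-freeness from few bad blocks -/

section Deterministic

variable {n m : ℕ}

/-- The chores of row `r` can be given to different agents who find them cheap. -/
def RowMatched (v : Fin n → Fin m → ℝ) (τ : ℝ) (r : ℕ) : Prop :=
  ∃ g : Fin m → Fin n, Set.InjOn g (choreBlock m n r) ∧ ∀ j ∈ choreBlock m n r, v (g j) j ≤ τ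

/-- All five rows of block `c` are matched, and no five chores of the block are cheap for two
agents at the same time. -/
structure BlockGood (v : Fin n → Fin m → ℝ) (τ T : ℝ) (c : ℕ) : Prop where
  rowMatched : ∀ r, r / 5 = c → RowMatched v τ r
  no_overlap : ∀ i i', i ≠ i' → ¬ ∃ J ⊆ choreBlock m (5 * n) c, J.card = 5 ∧
    ∀ j ∈ J, v i j ≤ T ∧ v i' j ≤ τ

/-- An assignment that matches every row that can be matched. -/
lemma exists_assignment (hn : 0 < n) (v : Fin n → Fin m → ℝ) (τ : ℝ) :
    ∃ g : Fin m → Fin n, ∀ r, RowMatched v τ r →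
      Set.InjOn g (choreBlock m n r) ∧ ∀ j ∈ choreBlock m n r, v (g j) j ≤ τ := by
  classical
  have : Nonempty (Fin n) := ⟨⟨0, hn⟩⟩
  choose! G hG using fun r (h : RowMatched v τ r) => h
  refine ⟨fun j => if RowMatched v τ (j.val / n) then G (j.val / n) j else ⟨0, hn⟩, ?_⟩
  intro r hr
  have heq : Set.EqOn (G r)
      (fun j => if RowMatched v τ (j.val / n) then G (j.val / n) j else ⟨0, hn⟩)
      (choreBlock m n r) := by
    intro j hj
    have hj' : j.val / n = r := mem_choreBlock.1 hj
    simp [hj', hr]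
  refine ⟨(hG r hr).1.congr heq, fun j hj => ?_⟩
  rw [← heq hj]
  exact (hG r hr).2 j hj

variable {v : Fin n → Fin m → ℝ} {τ T : ℝ} {g : Fin m → Fin n}

/-- The chores of block `c` that the assignment `g` gives to agent `i`. -/
def blockShare (g : Fin m → Fin n) (c : ℕ) (i : Fin n) : Finset (Fin m) :=
  (choreBlock m (5 * n) c).filter fun j => g j = i

lemma choreBlock_five_mul_div {j : Fin m} {c : ℕ} (hj : j ∈ choreBlock m (5 * n) c) :
    j.val / n / 5 = c := by
  rw [Nat.div_div_eq_div_mul, mul_comm]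
  exact mem_choreBlock.1 hj

/-- An agent receives at most one chore per row, so a share is counted by its rows. -/
lemma row_injOn_blockShare {c : ℕ} {i : Fin n}
    (hg : ∀ r, r / 5 = c → Set.InjOn g (choreBlock m n r)) :
    Set.InjOn (fun j : Fin m => j.val / n) (blockShare g c i) := by
  intro x hx y hy hxy
  simp only [blockShare, Finset.coe_filter, Set.mem_ofPred_eq] at hx hy
  have hxc := choreBlock_five_mul_div hx.1
  exact hg _ hxc (mem_choreBlock.2 rfl) (mem_choreBlock.2 hxy.symm) (hx.2.trans hy.2.symm)

lemma card_blockShare_le {c : ℕ} {i : Fin n}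
    (hg : ∀ r, r / 5 = c → Set.InjOn g (choreBlock m n r)) :
    (blockShare g c i).card ≤ 5 := by
  have h : (blockShare g c i).card ≤ (Finset.Ico (5 * c) (5 * c + 5)).card := by
    refine Finset.card_le_card_of_injOn _ (fun j hj => ?_) (row_injOn_blockShare hg)
    simp only [blockShare, Finset.coe_filter, Set.mem_ofPred_eq] at hj
    have := choreBlock_five_mul_div hj.1
    simp only [Finset.coe_Ico, Set.mem_Ico]
    omega
  simpa using h

lemma five_le_card_blockShare {c : ℕ} (hc : (c + 1) * (5 * n) ≤ m) {i : Fin n}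
    (hg : ∀ r, r / 5 = c → Set.InjOn g (choreBlock m n r)) :
    5 ≤ (blockShare g c i).card := by
  have hn : 0 < n := i.pos
  have hsub : Finset.Ico (5 * c) (5 * c + 5) ⊆ (blockShare g c i).image fun j => j.val / n := by
    intro r hr
    rw [Finset.mem_Ico] at hr
    have hrc : r / 5 = c := by omega
    have hfull : (choreBlock m n r).card = n := by
      refine card_choreBlock_eq hn (le_trans ?_ hc)
      rw [← mul_assoc]
      exact Nat.mul_le_mul_right _ (by omega)
    -- A full row has `n` chores, so the injective assignment reaches every agent.
    have himg : (choreBlock m n r).image g = Finset.univ := by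
      refine Finset.eq_univ_of_card _ ?_
      rw [Finset.card_image_of_injOn (hg r hrc), hfull, Fintype.card_fin]
    obtain ⟨j, hj, hji⟩ := Finset.mem_image.1 (himg ▸ Finset.mem_univ i)
    have hjr := mem_choreBlock.1 hj
    refine Finset.mem_image.2 ⟨j, Finset.mem_filter.2 ⟨mem_choreBlock.2 ?_, hji⟩, hjr⟩
    rw [mul_comm, ← Nat.div_div_eq_div_mul, hjr, hrc]
  have := (Finset.card_le_card hsub).trans Finset.card_image_le
  simpa using this

lemma sum_blockShare_le {c : ℕ} {i : Fin n} (hτ : 0 ≤ τ)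
    (hg : ∀ r, r / 5 = c → Set.InjOn g (choreBlock m n r) ∧ ∀ j ∈ choreBlock m n r, v (g j) j ≤ τ) :
    ∑ j ∈ blockShare g c i, v i j ≤ 5 * τ := by
  have h : ∀ j ∈ blockShare g c i, v i j ≤ τ := by
    intro j hj
    obtain ⟨hjc, rfl⟩ := Finset.mem_filter.1 hj
    exact (hg _ (choreBlock_five_mul_div hjc)).2 j (mem_choreBlock.2 rfl)
  refine (Finset.sum_le_card_nsmul _ _ _ h).trans ?_
  rw [nsmul_eq_mul]
  refine mul_le_mul_of_nonneg_right ?_ hτ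
  exact_mod_cast card_blockShare_le fun r hr => (hg r hr).1

/-- The share has exactly five chores, all cheap for their owner `i'`; by `no_overlap` one of them
exceeds `T` for `i`, and it suffices alone. -/
lemma le_sum_blockShare (hv : ∀ i j, 0 ≤ v i j) {c : ℕ} (hc : (c + 1) * (5 * n) ≤ m)
    (hgood : BlockGood v τ T c) {i i' : Fin n} (hi : i ≠ i')
    (hg : ∀ r, r / 5 = c → Set.InjOn g (choreBlock m n r) ∧ ∀ j ∈ choreBlock m n r, v (g j) j ≤ τ) :
    T ≤ ∑ j ∈ blockShare g c i', v i j := by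
  obtain ⟨j, hj, hTj⟩ : ∃ j ∈ blockShare g c i', T < v i j := by
    by_contra! hcon
    refine hgood.no_overlap i i' hi ⟨blockShare g c i', Finset.filter_subset _ _, ?_, ?_⟩
    · exact le_antisymm (card_blockShare_le fun r hr => (hg r hr).1)
        (five_le_card_blockShare hc fun r hr => (hg r hr).1)
    · intro j hj
      refine ⟨hcon j hj, ?_⟩
      obtain ⟨hjc, rfl⟩ := Finset.mem_filter.1 hj
      exact (hg _ (choreBlock_five_mul_div hjc)).2 j (mem_choreBlock.2 rfl)
  exact hTj.le.trans (Finset.single_le_sum (f := fun j => v i j) (fun j _ => hv i j) hj)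

/-- If few blocks are bad, then the assignment that matches all rows that can be matched is
envy-free: the slack of the good blocks outweighs the possible envy in the others. -/
lemma exists_isEnvyFree [∀ c, Decidable (BlockGood v τ (25 * τ) c)] (hn : 0 < n) (hm : 5 * n ≤ m)
    (hv : ∀ i j, v i j ∈ Set.Icc (0 : ℝ) 1) (hτ : 0 ≤ τ) (hτn : τ ≤ n / 2)
    (hbad : (((Finset.range (m / (5 * n))).filter fun c => ¬ BlockGood v τ (25 * τ) c).card : ℝ) ≤
      τ / n * (m / (5 * n) : ℕ))
    (hrem : ∀ r, r / 5 = m / (5 * n) → RowMatched v τ r) :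
    ∃ A : Fin n → Finset (Fin m), IsAllocation A ∧ IsEnvyFree v A := by
  obtain ⟨g, hg⟩ := exists_assignment hn v τ
  refine ⟨fun i => Finset.univ.filter fun j => g j = i, ⟨?_, fun j => ⟨g j, by simp⟩⟩, ?_⟩
  · intro i i' hi
    refine Finset.disjoint_left.2 fun j hj hj' => hi ?_
    simp only [Finset.mem_filter, Finset.mem_univ, true_and] at hj hj'
    exact hj.symm.trans hj'
  intro i i'
  rcases eq_or_ne i i' with rfl | hi
  · exact le_rfl
  set B := m / (5 * n) with hB
  have hB1 : 1 ≤ B := (Nat.one_le_div_iff (by omega)).2 hm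
  have hsplit : ∀ k, bundleDisutility (v i) (Finset.univ.filter fun j => g j = k) =
      ∑ c ∈ Finset.range B, ∑ j ∈ blockShare g c k, v i j + ∑ j ∈ blockShare g B k, v i j := by
    intro k
    rw [← Finset.sum_range_succ, bundleDisutility,
      ← Finset.sum_fiberwise_of_maps_to (s := Finset.univ.filter fun j => g j = k)
        -- Index `B` is the incomplete, possibly empty, last block.
        (t := Finset.range (B + 1)) (g := fun j : Fin m => j.val / (5 * n))]
    · refine Finset.sum_congr rfl fun c _ => Finset.sum_congr ?_ fun _ _ => rfl
      ext j
      simp [blockShare, mem_choreBlock, and_comm]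
    · intro j _
      exact Finset.mem_range.2 (Nat.lt_succ_of_le (Nat.div_le_div_right j.2.le))
  rw [hsplit, hsplit]
  have hv0 : ∀ i j, 0 ≤ v i j := fun i j => (hv i j).1
  have h1 : ∑ j ∈ blockShare g B i, v i j ≤ 5 * τ :=
    sum_blockShare_le hτ fun r hr => hg r (hrem r hr)
  have h2 : 0 ≤ ∑ j ∈ blockShare g B i', v i j := Finset.sum_nonneg fun j _ => hv0 i j
  -- The gain `20τ = 25τ - 5τ` is credited to every block; a bad block pays it back along with its
  -- worst-case cost `5n`.
  have h3 : ∀ c ∈ Finset.range B, ∑ j ∈ blockShare g c i, v i j ≤ ∑ j ∈ blockShare g c i', v i j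
      + (-(20 * τ) + if ¬ BlockGood v τ (25 * τ) c then 20 * τ + 5 * n else 0) := by
    intro c hc
    rw [Finset.mem_range] at hc
    have hcm : (c + 1) * (5 * n) ≤ m :=
      (Nat.mul_le_mul_right _ (show c + 1 ≤ B by omega)).trans (Nat.div_mul_le_self _ _)
    by_cases hgood : BlockGood v τ (25 * τ) c
    · have h4 := le_sum_blockShare hv0 hcm hgood hi fun r hr => hg r (hgood.rowMatched r hr)
      have h5 := sum_blockShare_le (i := i) hτ fun r hr => hg r (hgood.rowMatched r hr)
      simp only [hgood, not_true_eq_false, if_false]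
      linarith
    · have h4 : 0 ≤ ∑ j ∈ blockShare g c i', v i j := Finset.sum_nonneg fun j _ => hv0 i j
      have h5 : ∑ j ∈ blockShare g c i, v i j ≤ 5 * n := by
        refine (Finset.sum_le_card_nsmul _ _ 1 fun j _ => (hv i j).2).trans ?_
        rw [nsmul_eq_mul, mul_one]
        exact_mod_cast (Finset.card_filter_le _ _).trans (card_choreBlock_le (by omega) c)
      simp only [hgood, not_false_eq_true, if_true]
      linarith
  have h4 := Finset.sum_le_sum h3
  rw [Finset.sum_add_distrib, Finset.sum_add_distrib, Finset.sum_const, ← Finset.sum_filter,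
    Finset.sum_const, Finset.card_range, nsmul_eq_mul, nsmul_eq_mul] at h4
  have hn' : (0 : ℝ) < n := by exact_mod_cast hn
  have hB' : (1 : ℝ) ≤ B := by exact_mod_cast hB1
  have h6 : (((Finset.range B).filter fun c => ¬ BlockGood v τ (25 * τ) c).card : ℝ) *
      (20 * τ + 5 * n) ≤ 15 * τ * B := by
    refine (mul_le_mul_of_nonneg_right hbad (by positivity)).trans ?_
    have : τ / n ≤ 1 / 2 := by rw [div_le_iff₀ hn']; linarith
    calc τ / n * B * (20 * τ + 5 * n) = (20 * (τ / n) + 5) * (τ * B) := by field_simp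
      _ ≤ (20 * (1 / 2) + 5) * (τ * B) := by gcongr
      _ = 15 * τ * B := by ring
  -- The remaining slack `20τB - 15τB` covers the last block's `5τ`, since `B ≥ 1`.
  have h7 : τ * 1 ≤ τ * B := mul_le_mul_of_nonneg_left hB' hτ
  linarith

end Deterministic

/-! ### Asymptotic estimates -/

/-- Since `w ≥ n / 2`, the constant 12 gives `x ^ w ≤ n⁻⁶`, which beats the at most `n ^ (2 * u)`
choices and leaves `n ^ (-4 * u)`. -/
lemma choose_mul_choose_mul_pow_le {n u w : ℕ} {x : ℝ} (hu : 1 ≤ u) (huw : u ≤ w)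
    (hn : u + w = n + 1) (hx : 0 ≤ x) (hxe : x ≤ Real.exp (-(12 * Real.log n / n))) :
    (n.choose u * n.choose (u - 1) : ℝ) * x ^ (w * u) ≤ 1 / (n : ℝ) ^ 4 := by
  have hn1 : 1 ≤ n := by omega
  have hnR : (1 : ℝ) ≤ n := by exact_mod_cast hn1
  have hn0 : (0 : ℝ) < n := by linarith
  have hL : 0 ≤ Real.log n := Real.log_nonneg hnR
  have h1 : (n.choose u : ℝ) ≤ (n : ℝ) ^ u := by exact_mod_cast Nat.choose_le_pow n u
  have h2 : (n.choose (u - 1) : ℝ) ≤ (n : ℝ) ^ u := by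
    exact_mod_cast (Nat.choose_le_pow n (u - 1)).trans (Nat.pow_le_pow_right hn1 (by omega))
  have h3 : x ^ w ≤ 1 / (n : ℝ) ^ 6 := by
    refine (pow_le_pow_left₀ hx hxe w).trans ?_
    rw [← Real.exp_nat_mul]
    have h4 : (w : ℝ) * -(12 * Real.log n / n) ≤ -(6 * Real.log n) := by
      have hw : (n : ℝ) ≤ 2 * w := by exact_mod_cast (show n ≤ 2 * w by omega)
      have : 6 * Real.log n ≤ w * (12 * Real.log n / n) := by
        rw [← mul_div_assoc, le_div_iff₀ hn0]
        nlinarith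
      linarith
    refine (Real.exp_le_exp.2 h4).trans_eq ?_
    rw [Real.exp_neg, one_div, mul_comm, Real.exp_mul, Real.exp_log hn0]
    norm_cast
  calc (n.choose u * n.choose (u - 1) : ℝ) * x ^ (w * u)
      ≤ ((n : ℝ) ^ u * (n : ℝ) ^ u) * (1 / (n : ℝ) ^ 6) ^ u := by
        rw [pow_mul]
        gcongr
    _ = (1 / (n : ℝ) ^ 4) ^ u := by
        rw [← mul_pow, ← mul_pow]
        congr 1
        field_simp
    _ ≤ 1 / (n : ℝ) ^ 4 := by
        refine pow_le_of_le_one (by positivity) ?_ (by omega)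
        rw [div_le_one (by positivity)]
        exact one_le_pow₀ hnR

lemma sum_choose_mul_choose_mul_pow_le {n : ℕ} (hn : 0 < n) {x : ℝ} (hx : 0 ≤ x)
    (hxe : x ≤ Real.exp (-(12 * Real.log n / n))) :
    ∑ u ∈ Finset.Icc 1 n, (n.choose u * n.choose (u - 1) : ℝ) * x ^ ((n + 1 - u) * u) ≤
      1 / (n : ℝ) ^ 3 := by
  have h : ∀ u ∈ Finset.Icc 1 n,
      (n.choose u * n.choose (u - 1) : ℝ) * x ^ ((n + 1 - u) * u) ≤ 1 / (n : ℝ) ^ 4 := by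
    intro u hu
    rw [Finset.mem_Icc] at hu
    -- The summand is symmetric under `u ↦ n + 1 - u`.
    rcases le_total u (n + 1 - u) with huw | huw
    · exact choose_mul_choose_mul_pow_le hu.1 huw (by omega) hx hxe
    · have h1 := choose_mul_choose_mul_pow_le (u := n + 1 - u) (w := u) (by omega) huw
        (by omega) hx hxe
      have h2 : n.choose (n + 1 - u) = n.choose (u - 1) := by
        rw [← Nat.choose_symm (show u - 1 ≤ n by omega)]
        congr 1
        omega
      have h3 : n.choose (n + 1 - u - 1) = n.choose u := by
        rw [← Nat.choose_symm hu.2]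
        congr 1
        omega
      rwa [h2, h3, mul_comm (n.choose (u - 1) : ℝ), mul_comm u] at h1
  refine (Finset.sum_le_card_nsmul _ _ _ h).trans_eq ?_
  have hn0 : (n : ℝ) ≠ 0 := by exact_mod_cast hn.ne'
  rw [nsmul_eq_mul, Nat.card_Icc, Nat.add_sub_cancel]
  field_simp

/-- The threshold below which a disutility counts as cheap. -/
noncomputable def cheapThreshold (a : ℝ) (n : ℕ) : ℝ := 12 * Real.log n / (a * n)

/-- A bound on the probability that a block is bad. -/
noncomputable def badBlockBound (a b : ℝ) (n : ℕ) : ℝ :=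
  5 * (1 / (n : ℝ) ^ 3) + (n : ℝ) ^ 2 * ((5 * n : ℝ) ^ 5 *
    (b * (25 * cheapThreshold a n) * (b * cheapThreshold a n)) ^ 5)

open Filter Topology in
lemma tendsto_log_pow_div_natCast (k : ℕ) :
    Tendsto (fun n : ℕ => Real.log n ^ k / (n : ℝ)) atTop (𝓝 0) :=
  (Real.isLittleO_pow_log_id_atTop (n := k)).tendsto_div_nhds_zero.comp
    tendsto_natCast_atTop_atTop

-- This is where five rows are needed: with overlaps of size `k` the main term is `n ^ (4 - k)` up
-- to logarithms.
open Filter Topology in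
lemma eventually_badBlockBound_div_lt {a : ℝ} (ha : 0 < a) (b : ℝ) {ε : ℝ} (hε : 0 < ε) :
    ∀ᶠ n : ℕ in atTop,
      badBlockBound a b n / (cheapThreshold a n / n) + 5 * (1 / (n : ℝ) ^ 3) < ε := by
  have hinv : Tendsto (fun n : ℕ => ((n : ℝ))⁻¹) atTop (𝓝 0) :=
    tendsto_inv_atTop_zero.comp tendsto_natCast_atTop_atTop
  have hlog : Tendsto (fun n : ℕ => (Real.log n)⁻¹) atTop (𝓝 0) :=
    tendsto_inv_atTop_zero.comp (Real.tendsto_log_atTop.comp tendsto_natCast_atTop_atTop)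
  have h : Tendsto (fun n : ℕ => (5 * a / 12) * ((n : ℝ)⁻¹ * (Real.log n)⁻¹) +
      (5 ^ 5 * 25 ^ 5 * b ^ 10 * (12 / a) ^ 9) * (Real.log n ^ 9 / (n : ℝ)) +
      5 * ((n : ℝ)⁻¹) ^ 3) atTop (𝓝 0) := by
    have := (((hinv.mul hlog).const_mul (5 * a / 12)).add
      ((tendsto_log_pow_div_natCast 9).const_mul
        (5 ^ 5 * 25 ^ 5 * b ^ 10 * (12 / a) ^ 9))).add ((hinv.pow 3).const_mul 5)
    simpa using this
  filter_upwards [h.eventually (gt_mem_nhds hε), eventually_ge_atTop 2] with n hn hn2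
  have hn0 : (n : ℝ) ≠ 0 := by exact_mod_cast (show n ≠ 0 by omega)
  have hL : Real.log n ≠ 0 := (Real.log_pos (by exact_mod_cast hn2)).ne'
  refine lt_of_eq_of_lt ?_ hn
  rw [badBlockBound, cheapThreshold]
  field_simp

open Filter Topology in
lemma eventually_cheapThreshold_le (a : ℝ) {c : ℝ} (hc : 0 < c) :
    ∀ᶠ n : ℕ in atTop, cheapThreshold a n ≤ c := by
  have h := (tendsto_log_pow_div_natCast 1).const_mul (12 / a)
  rw [mul_zero] at h
  filter_upwards [h.eventually (gt_mem_nhds hc)] with n hn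
  refine le_of_eq_of_le ?_ hn.le
  rw [cheapThreshold, pow_one, div_mul_div_comm]

/-! ### Probabilities of the bad events -/

section RandomModel

variable {Ω : Type*} [MeasurableSpace Ω] {P : Measure Ω} {n m : ℕ}
  {α β : Fin m → ℝ} {D : Fin m → Measure ℝ} {d : Fin n → Fin m → Ω → ℝ} {a b : ℝ}

lemma measureReal_not_rowMatched_le [IsProbabilityMeasure P] (ha : 0 < a)
    (hD : ∀ j, a ≤ α j ∧ β j ≤ b ∧ IsDisutilityDistribution (D j) (α j) (β j))
    (h : IsRandomChoreInstance P D d) (hn : 0 < n) (hτ1 : cheapThreshold a n ≤ 1)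
    (haτ : a * cheapThreshold a n ≤ 1) (r : ℕ) :
    P.real {ω | ¬ RowMatched (fun i j => d i j ω) (cheapThreshold a n) r} ≤ 1 / (n : ℝ) ^ 3 := by
  have hn0 : (0 : ℝ) < n := by exact_mod_cast hn
  refine (h.measureReal_not_exists_injOn_le (sub_nonneg.2 haτ) (fun j => ?_) _
    (card_choreBlock_le hn r) hn).trans (sum_choose_mul_choose_mul_pow_le hn (sub_nonneg.2 haτ) ?_)
  · exact measureReal_Ioi_le_of_isDisutilityDistribution (hD j).2.2 (hD j).1 ha.le hτ1
  · have h1 : a * cheapThreshold a n = 12 * Real.log n / n := by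
      rw [cheapThreshold]
      field_simp
    rw [h1]
    exact Real.one_sub_le_exp_neg _

lemma measureReal_not_blockGood_le [IsProbabilityMeasure P] (ha : 0 < a) (hb : 0 ≤ b)
    (hD : ∀ j, a ≤ α j ∧ β j ≤ b ∧ IsDisutilityDistribution (D j) (α j) (β j))
    (h : IsRandomChoreInstance P D d) (hn : 0 < n) (hτ0 : 0 ≤ cheapThreshold a n)
    (hτ1 : 25 * cheapThreshold a n ≤ 1) (haτ : a * cheapThreshold a n ≤ 1) (c : ℕ) :
    P.real {ω | ¬ BlockGood (fun i j => d i j ω) (cheapThreshold a n) (25 * cheapThreshold a n) c} ≤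
      badBlockBound a b n := by
  classical
  set τ := cheapThreshold a n with hτ
  set O : Fin n × Fin n → Set Ω := fun q => {ω | ∃ J ⊆ choreBlock m (5 * n) c, J.card = 5 ∧
    ∀ j ∈ J, d q.1 j ω ≤ 25 * τ ∧ d q.2 j ω ≤ τ} with hO
  have hsub : {ω | ¬ BlockGood (fun i j => d i j ω) τ (25 * τ) c} ⊆
      (⋃ r ∈ Finset.Ico (5 * c) (5 * c + 5), {ω | ¬ RowMatched (fun i j => d i j ω) τ r}) ∪
      ⋃ q ∈ (Finset.univ : Finset (Fin n)).offDiag, O q := by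
    intro ω hω
    by_contra hcon
    simp only [Set.mem_union, Set.mem_iUnion, not_or, not_exists] at hcon
    refine hω ⟨fun r hr => ?_, fun i i' hi hJ => ?_⟩
    · by_contra hr'
      exact hcon.1 r (Finset.mem_Ico.2 (by omega)) hr'
    · exact hcon.2 (i, i') (by simp [hi]) hJ
  refine (measureReal_mono hsub (measure_ne_top _ _)).trans
    ((measureReal_union_le _ _).trans (add_le_add ?_ ?_))
  · refine (measureReal_biUnion_finset_le _ _).trans ((Finset.sum_le_card_nsmul _ _ _ fun r _ =>
      measureReal_not_rowMatched_le ha hD h hn (by linarith) haτ r).trans_eq ?_)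
    simp
  · have hterm : ∀ q ∈ (Finset.univ : Finset (Fin n)).offDiag,
        P.real (O q) ≤ (5 * n : ℝ) ^ 5 * (b * (25 * τ) * (b * τ)) ^ 5 := by
      intro q hq
      refine (h.measureReal_exists_overlap_le (p := b * (25 * τ)) (q := b * τ) (by positivity)
        (by positivity) (fun j => ?_) (fun j => ?_) 5 (choreBlock m (5 * n) c)
        (Finset.mem_offDiag.1 hq).2.2).trans ?_
      · exact measureReal_Iic_le_of_isDisutilityDistribution (hD j).2.2 (hD j).2.1 hb
          (by positivity) hτ1
      · exact measureReal_Iic_le_of_isDisutilityDistribution (hD j).2.2 (hD j).2.1 hb hτ0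
          (by linarith)
      · have hcard : ((choreBlock m (5 * n) c).card : ℝ) ≤ 5 * n := by
          exact_mod_cast card_choreBlock_le (by omega) c
        gcongr
    refine (measureReal_biUnion_finset_le _ _).trans
      ((Finset.sum_le_card_nsmul _ _ _ hterm).trans ?_)
    rw [nsmul_eq_mul]
    refine mul_le_mul_of_nonneg_right ?_ (by positivity)
    have : (Finset.univ : Finset (Fin n)).offDiag.card ≤ n ^ 2 := by
      rw [Finset.offDiag_card, Finset.card_univ, Fintype.card_fin, sq]
      exact Nat.sub_le _ _
    exact_mod_cast this

lemma measureReal_not_mem_Icc_eq_zero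
    (hD : ∀ j, a ≤ α j ∧ β j ≤ b ∧ IsDisutilityDistribution (D j) (α j) (β j))
    (h : IsRandomChoreInstance P D d) :
    P.real {ω | ¬ ∀ i j, d i j ω ∈ Set.Icc (0 : ℝ) 1} = 0 := by
  have h1 : ∀ᵐ ω ∂P, ∀ i j, d i j ω ∈ Set.Icc (0 : ℝ) 1 := by
    refine ae_all_iff.2 fun i => ae_all_iff.2 fun j => ?_
    have hl := h.hasLaw i j
    refine ae_of_ae_map hl.aemeasurable (p := fun x => x ∈ Set.Icc (0 : ℝ) 1) ?_
    rw [hl.map_eq]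
    exact (hD j).2.2.support
  rw [measureReal_def, show P {ω | ¬ ∀ i j, d i j ω ∈ Set.Icc (0 : ℝ) 1} = 0 from h1,
    ENNReal.toReal_zero]

end RandomModel

/-! ### Assembly -/

theorem mainTheorem2 (a b : ℝ) (ha : 0 < a) (ε : ℝ) (hε : 0 < ε) :
    ∃ n₀ : ℕ, ∀ n : ℕ, n₀ ≤ n → ∀ m : ℕ, 5 * n ≤ m →
      ∀ (α β : Fin m → ℝ) (D : Fin m → Measure ℝ),
        (∀ j, a ≤ α j ∧ β j ≤ b ∧ IsDisutilityDistribution (D j) (α j) (β j)) →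
        ∀ {Ω : Type*} [MeasurableSpace Ω] (P : Measure Ω) [IsProbabilityMeasure P]
          (d : Fin n → Fin m → Ω → ℝ), IsRandomChoreInstance P D d →
          1 - ε ≤ P.real {ω | ∃ A : Fin n → Finset (Fin m),
            IsAllocation A ∧ IsEnvyFree (fun i j => d i j ω) A} := by
  classical
  -- `max b 0` supplies the sign needed for the tail bounds; `n ≥ 2` makes `log n`, hence `τ`,
  -- positive.
  obtain ⟨n₀, hn₀⟩ := Filter.eventually_atTop.1
    ((eventually_badBlockBound_div_lt ha (max b 0) hε).and
    ((eventually_cheapThreshold_le a (c := 1 / 25) (by norm_num)).and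
      ((eventually_cheapThreshold_le a (c := 1 / a) (by positivity)).and
        (Filter.eventually_ge_atTop 2))))
  refine ⟨n₀, fun n hn m hm α β D hD Ω _ P _ d h => ?_⟩
  obtain ⟨hε', hτ25, hτa, hn2⟩ := hn₀ n hn
  have hD' : ∀ j, a ≤ α j ∧ β j ≤ max b 0 ∧ IsDisutilityDistribution (D j) (α j) (β j) :=
    fun j => ⟨(hD j).1, (hD j).2.1.trans (le_max_left _ _), (hD j).2.2⟩
  have hn0 : 0 < n := by omega
  have hnR : (2 : ℝ) ≤ n := by exact_mod_cast hn2
  have hB : 0 < m / (5 * n) := Nat.div_pos hm (by omega)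
  have hL : 0 < Real.log n := Real.log_pos (by linarith)
  have hτ0 : 0 < cheapThreshold a n := by
    rw [cheapThreshold]
    positivity
  have hτ1 : 25 * cheapThreshold a n ≤ 1 := by linarith
  have haτ : a * cheapThreshold a n ≤ 1 := by
    rw [mul_comm]
    exact (le_div_iff₀ ha).1 hτa
  set τ := cheapThreshold a n with hτ
  set B := m / (5 * n) with hBdef
  set bad : ℕ → Set Ω := fun c => {ω | ¬ BlockGood (fun i j => d i j ω) τ (25 * τ) c} with hbad
  set N : Set Ω := {ω | ¬ ∀ i j, d i j ω ∈ Set.Icc (0 : ℝ) 1} with hN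
  set M : Set Ω := {ω | τ / n * B < ((Finset.range B).filter fun c => ω ∈ bad c).card} with hM
  set R : Set Ω := ⋃ r ∈ Finset.Ico (5 * B) (5 * B + 5),
    {ω | ¬ RowMatched (fun i j => d i j ω) τ r} with hR
  set E : Set Ω := {ω | ∃ A : Fin n → Finset (Fin m),
    IsAllocation A ∧ IsEnvyFree (fun i j => d i j ω) A} with hE
  -- Covering the whole space and using subadditivity avoids measurability of `E`.
  have hcover : Set.univ ⊆ E ∪ (N ∪ M ∪ R) := by
    intro ω _
    by_contra hcon
    simp only [Set.mem_union, not_or] at hcon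
    obtain ⟨hE', ⟨hN', hM'⟩, hR'⟩ := hcon
    refine hE' (exists_isEnvyFree (τ := τ) hn0 hm (not_not.1 hN') hτ0.le (by linarith)
      (not_lt.1 hM') fun r hr => ?_)
    by_contra hr'
    refine hR' ?_
    simp only [hR, Set.mem_iUnion]
    exact ⟨r, Finset.mem_Ico.2 (by omega), hr'⟩
  have hPM : P.real M ≤ badBlockBound a (max b 0) n / (τ / n) :=
    measureReal_lt_card_filter_le P B bad (by positivity) hB fun c _ =>
      measureReal_not_blockGood_le ha (le_max_right _ _) hD' h hn0 hτ0.le hτ1 haτ c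
  have hPR : P.real R ≤ 5 * (1 / (n : ℝ) ^ 3) := by
    refine (measureReal_biUnion_finset_le _ _).trans ((Finset.sum_le_card_nsmul _ _ _ fun r _ =>
      measureReal_not_rowMatched_le ha hD h hn0 (by linarith) haτ r).trans_eq ?_)
    simp
  have hPN : P.real N = 0 := measureReal_not_mem_Icc_eq_zero hD h
  have h1 : (1 : ℝ) ≤ P.real (E ∪ (N ∪ M ∪ R)) := by
    rw [Set.univ_subset_iff.1 hcover, probReal_univ]
  have h2 := measureReal_union_le (μ := P) E (N ∪ M ∪ R)
  have h3 := measureReal_union_le (μ := P) (N ∪ M) R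
  have h4 := measureReal_union_le (μ := P) N M
  linarith
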